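/- Let $X$ be a proper geodesic metric space that is $\delta$-hyperbolic in the sense of Gromov for some $\delta\ge 0$. Let $\partial X$ be its boundary, the set of classes of asymptotic geodesic rays, where two rays are asymptotic if $d(r_1(t),r_2(t))$ is bounded for $t\ge 0$, and give $X\cup\partial X$ its usual topology. Assume: (U) any two distinct points of $X\cup\partial X$ are joined by a unique geodesic (for two points of $\partial X$: unique up to translation of the parameter); (C) for any two asymptotic geodesic rays $r_1,r_2$ there is $a\in\mathbb R$ with $\lim_{t\to\infty}d(r_1(t),r_2(t+a))=0$. Let $\Gamma$ be a discrete group of isometries of $X$, i.e. a group of isometries acting properly discontinuously: for every compact $K\subset X$ the set $\{\gamma\in\Gamma:\gamma K\cap K\ne\emptyset\}$ is finite. Its limit set is $\Lambda(\Gamma)=\overline{\Gamma x}\cap\partial X$, where $x\in X$ is arbitrary and the closure is taken in $X\cup\partial X$. Assume that $\Gamma$ is non-elementary, i.e. that $\Lambda(\Gamma)$ is infinite. Let $GX$ be the space of all isometric maps $g:\mathbb R\to X$ with the topology of uniform convergence on compact sets, and let $Y=X/\Gamma$. Let $GY=GX/\Gamma$ be the space of orbits of the action $(\gamma g)(t)=\gamma(g(t))$,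 with the quotient topology. The geodesic flow on $GY$ is induced by the flow $(t\cdot g)(s)=g(s+t)$ on $GX$. Its non-wandering set $\Omega$ is the set of all $g\in GY$ for which there are sequences $(g_n)$ in $GY$ and $(t_n)$ in $\mathbb R$ with $t_n\to+\infty$, $g_n\to g$ and $t_n\cdot g_n\to g$. Then $\Omega=GY$ if and only if $\Lambda(\Gamma)=\partial X$. -/

import Mathlib

open Filter Topology
open scoped NNReal

namespace HypFlow

section Metric

/-- `c` is a geodesic segment from `x` to `y`: an isometric map from the interval
`[0, d(x, y)]` with `c 0 = x` and `c (d(x, y)) = y`. -/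
def IsGeodesicSegment {X : Type*} [MetricSpace X] (x y : X)
    (c : Set.Icc (0 : ℝ) (dist x y) → X) : Prop :=
  Isometry c ∧ c ⟨0, le_refl 0, dist_nonneg⟩ = x ∧ c ⟨dist x y, dist_nonneg, le_refl _⟩ = y

/-- A geodesic metric space: every two points are joined by a geodesic segment. -/
def IsGeodesicSpace (X : Type*) [MetricSpace X] : Prop :=
  ∀ x y : X, ∃ c, IsGeodesicSegment x y c

/-- The Gromov product `(x | y)_p`. -/
noncomputable def gromovProduct {X : Type*} [MetricSpace X] (p x y : X) : ℝ :=
  (dist x p + dist y p - dist x y) / 2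

/-- Gromov hyperbolicity: `δ`-hyperbolic for some `δ ≥ 0`. -/
def IsGromovHyperbolic (X : Type*) [MetricSpace X] : Prop :=
  ∃ δ : ℝ, 0 ≤ δ ∧ ∀ p x y z : X,
    min (gromovProduct p x y) (gromovProduct p y z) - δ ≤ gromovProduct p x z

/-- Geodesic rays: isometric maps `[0, ∞) → X`. -/
def GeodesicRay (X : Type*) [MetricSpace X] : Type _ := {r : ℝ≥0 → X // Isometry r}

/-- Two rays are asymptotic if `d(r t, s t)` is bounded for `t ≥ 0`. -/
def Asymptotic {X : Type*} [MetricSpace X] (r s : GeodesicRay X) : Prop :=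
  ∃ C : ℝ, ∀ t : ℝ≥0, dist (r.1 t) (s.1 t) ≤ C

/-- The asymptoty relation on rays. -/
def asymptoticSetoid (X : Type*) [MetricSpace X] : Setoid (GeodesicRay X) where
  r := Asymptotic
  iseqv :=
    { refl := fun r => ⟨0, fun t => by simp⟩
      symm := fun ⟨C, h⟩ => ⟨C, fun t => by rw [dist_comm]; exact h t⟩
      trans := fun ⟨C, h⟩ ⟨D, k⟩ =>
        ⟨C + D, fun t => (dist_triangle _ _ _).trans (add_le_add (h t) (k t))⟩ }

/-- The boundary at infinity `∂X`: asymptoty classes of geodesic rays. -/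
def Boundary (X : Type*) [MetricSpace X] : Type _ := Quotient (asymptoticSetoid X)

/-- The boundary point `r(+∞)` of a ray. -/
def GeodesicRay.endpoint {X : Type*} [MetricSpace X] (r : GeodesicRay X) : Boundary X :=
  Quotient.mk (asymptoticSetoid X) r

/-- The set `X ∪ ∂X`. -/
inductive Bordification (X : Type*) [MetricSpace X] where
  | inner (x : X) : Bordification X
  | ideal (ξ : Boundary X) : Bordification X

/-- The paths along which a point of `X ∪ ∂X` is approached: the constant path at a point of `X`,
the geodesic rays that end at a point of `∂X`. -/
def Bordification.paths {X : Type*} [MetricSpace X] : Bordification X → Set (ℝ≥0 → X)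
  | .inner x => {fun _ => x}
  | .ideal ξ => {c | ∃ r : GeodesicRay X, r.endpoint = ξ ∧ r.1 = c}

/-- The Gromov product extended to `X ∪ ∂X`:
`(z | w)_p = sup liminf_{s, t → ∞} (c s | c' t)_p`, the supremum being over the paths `c` to `z`
and `c'` to `w`. It is the usual product if `z` and `w` are in `X`. -/
noncomputable def extGromovProduct {X : Type*} [MetricSpace X] (p : X) (z w : Bordification X) :
    EReal :=
  ⨆ c ∈ z.paths, ⨆ c' ∈ w.paths,
    liminf (fun st : ℝ≥0 × ℝ≥0 => ((gromovProduct p (c st.1) (c' st.2) : ℝ) : EReal))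
      (atTop ×ˢ atTop)

/-- The usual topology of `X ∪ ∂X`: `X` is open and carries its metric topology, and the sets
`{z | (ξ | z)_p > R}` are a neighbourhood base at `ξ ∈ ∂X`. A change of the base point `p` changes
the products by a bounded amount only, so that it does not matter which one is used. -/
instance (X : Type*) [MetricSpace X] : TopologicalSpace (Bordification X) where
  IsOpen U := IsOpen {x : X | Bordification.inner x ∈ U} ∧
    ∀ ξ : Boundary X, Bordification.ideal ξ ∈ U → ∀ p : X, ∃ R : ℝ, ∀ z : Bordification X,
      (R : EReal) < extGromovProduct p (.ideal ξ) z → z ∈ U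
  isOpen_univ := ⟨by simp, fun _ _ _ => ⟨0, fun _ _ => trivial⟩⟩
  isOpen_inter := fun U V hU hV => by
    refine ⟨hU.1.inter hV.1, fun ξ hξ p => ?_⟩
    obtain ⟨R, hR⟩ := hU.2 ξ hξ.1 p
    obtain ⟨S, hS⟩ := hV.2 ξ hξ.2 p
    refine ⟨max R S, fun z hz => ⟨hR z (lt_of_le_of_lt ?_ hz), hS z (lt_of_le_of_lt ?_ hz)⟩⟩
    · exact EReal.coe_le_coe_iff.2 (le_max_left R S)
    · exact EReal.coe_le_coe_iff.2 (le_max_right R S)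
  isOpen_sUnion := fun 𝒰 h𝒰 => by
    refine ⟨?_, fun ξ hξ p => ?_⟩
    · have : {x : X | Bordification.inner x ∈ ⋃₀ 𝒰} =
          ⋃ U ∈ 𝒰, {x : X | Bordification.inner x ∈ U} := by
        ext x; simp
      rw [this]
      exact isOpen_biUnion fun U hU => (h𝒰 U hU).1
    · obtain ⟨U, hU, hξU⟩ := hξ
      obtain ⟨R, hR⟩ := (h𝒰 U hU).2 ξ hξU p
      exact ⟨R, fun z hz => ⟨U, hU, hR z hz⟩⟩

/-- The space `GX` of geodesics of `X`: isometric maps `ℝ → X`, with the topology of uniform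
convergence on compact sets (the compact-open topology of `C(ℝ, X)`). -/
abbrev GeodesicLine (X : Type*) [MetricSpace X] : Type _ := {g : C(ℝ, X) // Isometry g}

/-- The ray `g|[0, ∞)`. -/
def GeodesicLine.posRay {X : Type*} [MetricSpace X] (g : GeodesicLine X) : GeodesicRay X :=
  ⟨fun t => g.1 t, g.2.comp NNReal.isometry_coe⟩

/-- The ray `t ↦ g(-t)`, `t ≥ 0`. -/
def GeodesicLine.negRay {X : Type*} [MetricSpace X] (g : GeodesicLine X) : GeodesicRay X :=
  ⟨fun t => g.1 (-t), g.2.comp ((IsometryEquiv.neg ℝ).isometry.comp NNReal.isometry_coe)⟩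

/-- The geodesic flow on `GX`: `(t · g)(s) = g(s + t)`. -/
def GeodesicLine.flow {X : Type*} [MetricSpace X] (t : ℝ) (g : GeodesicLine X) : GeodesicLine X :=
  ⟨⟨fun s => g.1 (s + t), by fun_prop⟩, g.2.comp (IsometryEquiv.addRight t).isometry⟩

/-- Condition (U): any two distinct points of `X ∪ ∂X` are joined by a unique geodesic: a segment
for two points of `X`, a ray for a point of `X` and a point of `∂X`, and a line, unique up to a
translation of the parameter, for two distinct points of `∂X`. -/
structure HasUniqueGeodesics (X : Type*) [MetricSpace X] : Prop where
  segment : ∀ x y : X, ∃! c, IsGeodesicSegment x y c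
  ray : ∀ (x : X) (ξ : Boundary X), ∃! r : GeodesicRay X, r.1 0 = x ∧ r.endpoint = ξ
  line : ∀ ξ η : Boundary X, ξ ≠ η →
    ∃ g : GeodesicLine X, (g.negRay.endpoint = ξ ∧ g.posRay.endpoint = η) ∧
      ∀ h : GeodesicLine X, h.negRay.endpoint = ξ → h.posRay.endpoint = η →
        ∃ t : ℝ, h = g.flow t

/-- Condition (C): for asymptotic rays `r`, `s` there is `a ∈ ℝ` with `d(r t, s(t + a)) → 0` as
`t → ∞`. The truncation `Real.toNNReal` only affects bounded sets of `t`. The same condition for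
geodesic lines that are asymptotic as `t → ∞` is this one for the restrictions to `[0, ∞)`. -/
def HasConvergentGeodesics (X : Type*) [MetricSpace X] : Prop :=
  ∀ r s : GeodesicRay X, Asymptotic r s →
    ∃ a : ℝ, Tendsto (fun t : ℝ => dist (r.1 t.toNNReal) (s.1 (t + a).toNNReal)) atTop (𝓝 0)

end Metric

section Group

/-- Proper discontinuity of the action on `X` of a group of isometries: for every compact `K`,
only finitely many `γ ∈ Γ` satisfy `γK ∩ K ≠ ∅`. -/
def ActsProperlyDiscontinuously {X : Type*} [MetricSpace X] (Γ : Subgroup (X ≃ᵢ X)) : Prop :=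
  ∀ K : Set X, IsCompact K → {γ : X ≃ᵢ X | γ ∈ Γ ∧ ((γ '' K) ∩ K).Nonempty}.Finite

/-- The limit set: the points of `∂X` in the closure in `X ∪ ∂X` of the orbit of `x`. (It does not
depend on `x`.) -/
def limitSet {X : Type*} [MetricSpace X] (Γ : Subgroup (X ≃ᵢ X)) (x : X) : Set (Boundary X) :=
  {ξ | Bordification.ideal ξ ∈
    closure {z : Bordification X | ∃ γ ∈ Γ, z = Bordification.inner (γ x)}}

/-- A group is non-elementary if its limit set is infinite. -/
def IsNonElementary {X : Type*} [MetricSpace X] (Γ : Subgroup (X ≃ᵢ X)) : Prop :=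
  ∃ x : X, (limitSet Γ x).Infinite

/-- `g` and `h` in `GX` are in the same `Γ`-orbit, where `(γ g)(t) = γ(g t)`. -/
def orbitSetoid {X : Type*} [MetricSpace X] (Γ : Subgroup (X ≃ᵢ X)) : Setoid (GeodesicLine X) where
  r g h := ∃ γ ∈ Γ, ∀ t : ℝ, γ (g.1 t) = h.1 t
  iseqv :=
    { refl := fun g => ⟨1, Γ.one_mem, fun t => rfl⟩
      symm := fun ⟨γ, hγ, h⟩ => ⟨γ⁻¹, Γ.inv_mem hγ, fun t => by
        rw [← h t]; exact γ.symm_apply_apply _⟩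
      trans := fun ⟨γ, hγ, h⟩ ⟨γ', hγ', h'⟩ => ⟨γ' * γ, Γ.mul_mem hγ' hγ, fun t => by
        rw [← h' t, ← h t]; rfl⟩ }

/-- The space `GY = GX / Γ`, where `Y = X / Γ`. -/
def QuotientGeodesics {X : Type*} [MetricSpace X] (Γ : Subgroup (X ≃ᵢ X)) : Type _ :=
  Quotient (orbitSetoid Γ)

/-- `GY` has the quotient topology. -/
instance {X : Type*} [MetricSpace X] (Γ : Subgroup (X ≃ᵢ X)) :
    TopologicalSpace (QuotientGeodesics Γ) :=
  inferInstanceAs (TopologicalSpace (Quotient (orbitSetoid Γ)))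

/-- The geodesic flow on `GY`: `t · p(g) = p(t · g)`. -/
def QuotientGeodesics.flow {X : Type*} [MetricSpace X] {Γ : Subgroup (X ≃ᵢ X)} (t : ℝ) :
    QuotientGeodesics Γ → QuotientGeodesics Γ :=
  Quotient.map (GeodesicLine.flow t) fun _ _ ⟨γ, hγ, h⟩ => ⟨γ, hγ, fun s => h (s + t)⟩

/-- The non-wandering set `Ω` of the geodesic flow on `GY`. -/
def nonWanderingSet {X : Type*} [MetricSpace X] (Γ : Subgroup (X ≃ᵢ X)) :
    Set (QuotientGeodesics Γ) :=
  {g | ∃ (u : ℕ → QuotientGeodesics Γ) (t : ℕ → ℝ), Tendsto t atTop atTop ∧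
    Tendsto u atTop (𝓝 g) ∧ Tendsto (fun n => (u n).flow (t n)) atTop (𝓝 g)}

end Group

end HypFlow

/-!
The Gromov product `(x | y)_o` alone carries the argument: a point of `X ∪ ∂X` is represented by a
path (constant, or a ray), and `EndsClose o R c c'` says that two of them have product at least `R`
at `o`. Convergence is taken along an ultrafilter, so that no subsequence has to be extracted.

If a line `g` is non-wandering modulo `Γ`, then lines `h` close to `g` have points `h t`, with `t`
large, close to the orbit of `g 0`. As `h` follows `g` for a long time, orbit points tend to `g(+∞)`
(`posRay_endpoint_mem_limitSet`). Since `∂X` has at least two points, each `ξ ∈ ∂X` is the forward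
end of a line, whence `Λ(Γ) = ∂X`.

For the converse, the ends `ξ = g(-∞)` and `η = g(+∞)` are limit points. They are dual
(`exists_dual`): some `γ n ∈ Γ` satisfy `γ n o → ξ` and `(γ n)⁻¹ o → η`. By
`EndsTendsto.image`, `γ n` then contracts the complement of `η` to `ξ`, and its inverse
contracts the complement of `ξ` to `η`. So the line from `ξ` to `(γ n)⁻¹ η` and its image, the line
from `γ n ξ` to `η`, have ends close to those of `g`. By uniqueness of geodesics and properness both
are close to `g` up to parametrization (`exists_reparam_tendsto`), and the time between
the two parametrizations tends to `+∞`.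

To get duality, take `α n o → ξ` and `β n o → η` in the orbit, with `(α n)⁻¹ o → a` and
`(β n)⁻¹ o → b`. Then `γ n = α n σ (β n)⁻¹` works for any `σ ∈ Γ` with `σ b ≠ a`. Such a `σ`
exists because a discrete group with infinite limit set fixes no point of `∂X`
(`exists_not_asymptotic_map`). This is where discreteness and the convergence of asymptotic rays are
used: if `Γ` fixed the end of a ray, all its elements would translate the ray up to an error that
vanishes at infinity, and commutators, conjugated back to a base point, would range in a finite set.
-/

namespace HypFlow

/-! ### Gromov products and rays -/

section Products

variable {X : Type*} [MetricSpace X]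

/-- The four-point inequality of `δ`-hyperbolicity, for a given constant `δ`. -/
def HyperbolicWith (X : Type*) [MetricSpace X] (δ : ℝ) : Prop :=
  ∀ p x y z : X, min (gromovProduct p x y) (gromovProduct p y z) - δ ≤ gromovProduct p x z

lemma gromovProduct_comm (p x y : X) : gromovProduct p x y = gromovProduct p y x := by
  simp only [gromovProduct, dist_comm x y]; ring

lemma gromovProduct_nonneg (p x y : X) : 0 ≤ gromovProduct p x y := by
  have := dist_triangle x p y
  rw [dist_comm p y] at this
  unfold gromovProduct; linarith

lemma gromovProduct_le_left (p x y : X) : gromovProduct p x y ≤ dist x p := by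
  have := dist_triangle y x p
  rw [dist_comm y x] at this
  unfold gromovProduct; linarith

lemma gromovProduct_le_right (p x y : X) : gromovProduct p x y ≤ dist y p := by
  rw [gromovProduct_comm]; exact gromovProduct_le_left p y x

lemma gromovProduct_base_sub_le (p q x y : X) :
    gromovProduct p x y - dist p q ≤ gromovProduct q x y := by
  have h1 := dist_triangle x q p
  have h2 := dist_triangle y q p
  rw [dist_comm q p] at h1 h2
  unfold gromovProduct; linarith

lemma gromovProduct_left_sub_le (p x x' y : X) :
    gromovProduct p x y - dist x x' ≤ gromovProduct p x' y := by
  have h1 := dist_triangle x x' p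
  have h2 := dist_triangle x' x y
  rw [dist_comm x' x] at h2
  unfold gromovProduct; linarith

lemma gromovProduct_isometry (γ : X ≃ᵢ X) (p x y : X) :
    gromovProduct (γ p) (γ x) (γ y) = gromovProduct p x y := by
  simp [gromovProduct, γ.dist_eq]

lemma gromovProduct_add_swap (p q x : X) :
    gromovProduct p x q + gromovProduct q x p = dist p q := by
  simp only [gromovProduct, dist_comm q p]; ring

/-- For `y` far from `γ⁻¹ o` as seen from `o`, the image `γ y` is close to `γ o`: the identity
behind the contraction of `X ∪ ∂X` by a divergent sequence of isometries. -/
lemma gromovProduct_image (γ : X ≃ᵢ X) (o y : X) :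
    gromovProduct o (γ y) (γ o) = dist (γ o) o - gromovProduct o y (γ⁻¹ o) := by
  have h := gromovProduct_add_swap o (γ o) (γ y)
  have h2 : gromovProduct (γ o) (γ y) o = gromovProduct o y (γ⁻¹ o) := by
    rw [← gromovProduct_isometry γ o y (γ⁻¹ o),
      IsometryEquiv.apply_inv_self γ o]
  rw [dist_comm] at h; linarith

lemma dist_eq_sub_gromovProduct (p x y : X) :
    dist x y = dist x p + dist y p - 2 * gromovProduct p x y := by
  unfold gromovProduct; ring

lemma HyperbolicWith.chain {δ : ℝ} (hδ : HyperbolicWith X δ) {p x y z : X} {R : ℝ}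
    (h1 : R ≤ gromovProduct p x y) (h2 : R ≤ gromovProduct p y z) :
    R - δ ≤ gromovProduct p x z :=
  (sub_le_sub_right (le_min h1 h2) δ).trans (hδ p x y z)

lemma HyperbolicWith.nonneg {δ : ℝ} (hδ : HyperbolicWith X δ) (x : X) : 0 ≤ δ := by
  have := hδ x x x x
  simp [gromovProduct] at this
  exact this

/-- If `w` lies on a geodesic from `y` to `z`, at the distance `(o | z)_y` from `y`, then it is
almost a nearest point to `o`. -/
lemma HyperbolicWith.dist_le_of_between {δ : ℝ} (hδ : HyperbolicWith X δ) {o y w z : X}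
    (h1 : dist y w = gromovProduct y o z) (h2 : dist y w + dist w z = dist y z) :
    dist w o ≤ gromovProduct o y z + 2 * δ := by
  have h := hδ w y o z
  have hc := dist_comm o y
  have hc2 := dist_comm o w
  have hc3 := dist_comm z w
  have hc4 := dist_comm z y
  have hc5 := dist_comm z o
  simp only [gromovProduct] at *
  rcases min_choice ((dist y w + dist o w - dist y o) / 2)
    ((dist o w + dist z w - dist o z) / 2) with h' | h' <;> rw [h'] at h <;> linarith

/-- A point at bounded distance from `o` on a geodesic arc whose ends have a bounded Gromov product
at `o`. -/
lemma HyperbolicWith.exists_dist_le {δ : ℝ} (hδ : HyperbolicWith X δ) (o : X) {f : ℝ → X} {a b : ℝ}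
    (hab : a ≤ b) (hf : ∀ s ∈ Set.Icc a b, ∀ t ∈ Set.Icc a b, dist (f s) (f t) = |s - t|) :
    ∃ s ∈ Set.Icc a b, dist (f s) o ≤ gromovProduct o (f a) (f b) + 2 * δ := by
  have hd : dist (f a) (f b) = b - a := by
    rw [hf a ⟨le_rfl, hab⟩ b ⟨hab, le_rfl⟩, abs_sub_comm, abs_of_nonneg (by linarith)]
  have h0 := gromovProduct_nonneg (f a) o (f b)
  have h1 := gromovProduct_le_right (f a) o (f b)
  rw [dist_comm, hd] at h1
  have hs : a + gromovProduct (f a) o (f b) ∈ Set.Icc a b := ⟨by linarith, by linarith⟩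
  refine ⟨_, hs, hδ.dist_le_of_between ?_ ?_⟩
  · rw [hf a ⟨le_rfl, hab⟩ _ hs, abs_sub_comm, abs_of_nonneg] <;> linarith
  · rw [hf a ⟨le_rfl, hab⟩ _ hs, hf _ hs b ⟨hab, le_rfl⟩, hd, abs_of_nonpos (by linarith),
      abs_of_nonpos (by linarith [hs.2])]
    ring

end Products

section Close

variable {X : Type*} [MetricSpace X]

/-- The Gromov product at `o` of the ends of two paths is at least `R`: a point of `X ∪ ∂X` is
represented by a path, constant for a point of `X` and a ray for a point of `∂X`. -/
def EndsClose (o : X) (R : ℝ) (c c' : ℝ≥0 → X) : Prop :=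
  ∀ᶠ t in atTop, R ≤ gromovProduct o (c t) (c' t)

/-- The ends of the paths `c i` tend to the end of `c`, along the filter `l`. -/
def EndsTendsto {ι : Type*} (o : X) (l : Filter ι) (c : ι → ℝ≥0 → X) (c' : ℝ≥0 → X) : Prop :=
  ∀ R : ℝ, ∀ᶠ i in l, EndsClose o R (c i) c'

variable {o : X} {R S δ : ℝ} {c c' c'' : ℝ≥0 → X}

lemma EndsClose.symm (h : EndsClose o R c c') : EndsClose o R c' c :=
  h.mono fun _ ht => by rwa [gromovProduct_comm]

lemma EndsClose.mono (h : EndsClose o R c c') (hS : S ≤ R) : EndsClose o S c c' :=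
  Eventually.mono h fun _ ht => hS.trans ht

lemma EndsClose.trans (hδ : HyperbolicWith X δ) (h : EndsClose o R c c')
    (h' : EndsClose o R c' c'') : EndsClose o (R - δ) c c'' := by
  filter_upwards [h, h'] with t h1 h2 using hδ.chain h1 h2

lemma EndsClose.base (h : EndsClose o R c c') (p : X) : EndsClose p (R - dist o p) c c' :=
  Eventually.mono h fun t ht => by
    have := gromovProduct_base_sub_le o p (c t) (c' t); linarith

lemma EndsClose.of_dist_le (h : EndsClose o R c c') {K : ℝ}
    (hK : ∀ᶠ t in atTop, dist (c t) (c'' t) ≤ K) : EndsClose o (R - K) c'' c' := by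
  filter_upwards [h, hK] with t h1 h2
  have := gromovProduct_left_sub_le o (c t) (c'' t) (c' t); linarith

lemma EndsClose.map (h : EndsClose o R c c') (γ : X ≃ᵢ X) :
    EndsClose o (R - dist (γ o) o) (fun t => γ (c t)) (fun t => γ (c' t)) := by
  have : EndsClose (γ o) R (fun t => γ (c t)) (fun t => γ (c' t)) :=
    Eventually.mono h fun t ht => by rwa [gromovProduct_isometry]
  exact this.base o

lemma GeodesicRay.dist_eq (r : GeodesicRay X) (s t : ℝ≥0) :
    dist (r.1 s) (r.1 t) = |(s : ℝ) - t| := by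
  rw [r.2.dist_eq, NNReal.dist_eq]

lemma GeodesicRay.dist_zero (r : GeodesicRay X) (t : ℝ≥0) : dist (r.1 0) (r.1 t) = t := by
  rw [r.dist_eq]; simp

lemma GeodesicRay.le_gromovProduct (o : X) (r : GeodesicRay X) {s t : ℝ≥0} (h : s ≤ t) :
    s - dist (r.1 0) o ≤ gromovProduct o (r.1 s) (r.1 t) := by
  have h1 := dist_triangle (r.1 0) o (r.1 s)
  have h2 := dist_triangle (r.1 0) o (r.1 t)
  have h3 := r.dist_eq s t
  rw [abs_sub_comm, abs_of_nonneg (by simpa using h)] at h3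
  rw [r.dist_zero, dist_comm o] at h1 h2
  unfold gromovProduct; linarith

/-- Two rays with a common end stay close, uniformly in terms of their distance at time `0`. -/
lemma GeodesicRay.dist_le_of_frequently (hδ : HyperbolicWith X δ) (r s : GeodesicRay X)
    (h : ∀ K : ℝ, ∃ᶠ t in atTop, K ≤ gromovProduct o (r.1 t) (s.1 t)) {D : ℝ}
    (hr : dist (r.1 0) o ≤ D) (hs : dist (s.1 0) o ≤ D) (t : ℝ≥0) :
    dist (r.1 t) (s.1 t) ≤ 4 * D + 4 * δ := by
  obtain ⟨u, hu, hut⟩ := ((h t).and_eventually (eventually_ge_atTop t)).exists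
  have hD := dist_nonneg.trans hr
  have h1 := r.le_gromovProduct o hut
  have h2 := s.le_gromovProduct o hut
  have h4 := hδ.nonneg o
  rw [gromovProduct_comm] at h2
  have h3 : t - D - δ ≤ gromovProduct o (r.1 t) (s.1 u) :=
    hδ.chain (y := r.1 u) (by linarith) (by linarith)
  have h3' : t - D - δ - δ ≤ gromovProduct o (r.1 t) (s.1 t) :=
    hδ.chain (y := s.1 u) h3 (by linarith)
  have h5 := dist_triangle (r.1 t) (r.1 0) o
  have h6 := dist_triangle (s.1 t) (s.1 0) o
  rw [dist_comm _ (r.1 0), r.dist_zero] at h5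
  rw [dist_comm _ (s.1 0), s.dist_zero] at h6
  rw [dist_eq_sub_gromovProduct o]; linarith

lemma Asymptotic.of_frequently (hδ : HyperbolicWith X δ) {r s : GeodesicRay X}
    (h : ∀ K : ℝ, ∃ᶠ t in atTop, K ≤ gromovProduct o (r.1 t) (s.1 t)) : Asymptotic r s :=
  ⟨_, r.dist_le_of_frequently hδ s h (le_max_left _ _) (le_max_right _ _)⟩

lemma Asymptotic.of_endsClose (hδ : HyperbolicWith X δ) {r s : GeodesicRay X}
    (h : ∀ K : ℝ, EndsClose o K r.1 s.1) : Asymptotic r s :=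
  .of_frequently hδ fun K => (h K).frequently

lemma GeodesicRay.tendsto_dist (r : GeodesicRay X) (o : X) :
    Tendsto (fun t => dist (r.1 t) o) atTop atTop := by
  refine tendsto_atTop_mono (f := fun t : ℝ≥0 => (t : ℝ) - dist (r.1 0) o) (fun t => ?_) ?_
  · have := dist_triangle (r.1 t) o (r.1 0)
    rw [dist_comm (r.1 t), r.dist_zero, dist_comm o] at this
    linarith
  · exact tendsto_atTop_add_const_right _ _ (NNReal.tendsto_coe_atTop.2 tendsto_id)

lemma GeodesicRay.endsClose_of_dist_le (r : GeodesicRay X) {c : ℝ≥0 → X} {C : ℝ}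
    (h : ∀ᶠ t in atTop, dist (r.1 t) (c t) ≤ C) (o : X) (K : ℝ) : EndsClose o K r.1 c := by
  filter_upwards [(r.tendsto_dist o).eventually_ge_atTop (K + C), h] with t ht hC
  have := gromovProduct_left_sub_le o (r.1 t) (c t) (r.1 t)
  have h2 : gromovProduct o (r.1 t) (r.1 t) = dist (r.1 t) o := by simp [gromovProduct]
  rw [gromovProduct_comm]; linarith

lemma Asymptotic.endsClose {r s : GeodesicRay X} (h : Asymptotic r s) (o : X) (K : ℝ) :
    EndsClose o K r.1 s.1 := by
  obtain ⟨C, hC⟩ := h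
  exact r.endsClose_of_dist_le (.of_forall hC) o K

lemma exists_gromovProduct_lt_of_not_asymptotic (hδ : HyperbolicWith X δ) {r s : GeodesicRay X}
    (h : ¬ Asymptotic r s) (o : X) :
    ∃ K : ℝ, ∀ᶠ t in atTop, gromovProduct o (r.1 t) (s.1 t) < K := by
  by_contra! hc
  exact h (.of_frequently (o := o) hδ fun K => by simpa using hc K)

/-- The image of a ray under an isometry. -/
def GeodesicRay.map (γ : X ≃ᵢ X) (r : GeodesicRay X) : GeodesicRay X :=
  ⟨fun t => γ (r.1 t), γ.isometry.comp r.2⟩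

lemma Asymptotic.map {r s : GeodesicRay X} (h : Asymptotic r s) (γ : X ≃ᵢ X) :
    Asymptotic (r.map γ) (s.map γ) := by
  obtain ⟨C, hC⟩ := h
  exact ⟨C, fun t => by simpa [GeodesicRay.map, γ.dist_eq] using hC t⟩

lemma Asymptotic.symm {r s : GeodesicRay X} (h : Asymptotic r s) : Asymptotic s r :=
  (asymptoticSetoid X).symm h

lemma Asymptotic.trans {r s u : GeodesicRay X} (h : Asymptotic r s) (h' : Asymptotic s u) :
    Asymptotic r u :=
  (asymptoticSetoid X).trans h h'

lemma endpoint_eq_iff {r s : GeodesicRay X} : r.endpoint = s.endpoint ↔ Asymptotic r s :=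
  Quotient.eq (r := asymptoticSetoid X)

lemma exists_endpoint_eq (ξ : Boundary X) : ∃ r : GeodesicRay X, r.endpoint = ξ :=
  Quotient.exists_rep ξ

end Close

/-! ### The topology at infinity and the limit set -/

section LimitSet

variable {X : Type*} [MetricSpace X] {δ : ℝ}

lemma exists_endsClose_of_lt_ext {p : X} {R : ℝ} {ξ : Boundary X} {w : Bordification X}
    (h : (R : EReal) < extGromovProduct p (.ideal ξ) w) :
    ∃ r : GeodesicRay X, r.endpoint = ξ ∧ ∃ c ∈ w.paths, EndsClose p R r.1 c := by
  unfold extGromovProduct at h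
  simp only [lt_iSup_iff] at h
  obtain ⟨c, ⟨r, hr, rfl⟩, c', hc', h⟩ := h
  refine ⟨r, hr, c', hc', ?_⟩
  have h1 := eventually_lt_of_lt_liminf h
  have h2 : Tendsto (fun t : ℝ≥0 => (t, t)) atTop (atTop ×ˢ atTop) := tendsto_id.prodMk tendsto_id
  exact (h2.eventually h1).mono fun t ht => (EReal.coe_lt_coe_iff.1 ht).le

lemma lt_ext_of_endsClose {p x : X} {R : ℝ} {r : GeodesicRay X}
    (h : EndsClose p (R + 1) r.1 fun _ => x) :
    (R : EReal) < extGromovProduct p (.ideal r.endpoint) (.inner x) := by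
  unfold extGromovProduct
  refine lt_of_lt_of_le (EReal.coe_lt_coe_iff.2 (lt_add_one R)) ?_
  refine le_iSup₂_of_le r.1 ⟨r, rfl, rfl⟩ (le_iSup₂_of_le (fun _ => x) rfl ?_)
  refine le_liminf_of_le (by isBoundedDefault) ?_
  exact (h.prod_inl _).mono fun st hst => EReal.coe_le_coe_iff.2 hst

/-- A neighbourhood of the end of `r` in `X ∪ ∂X`, whose points in `X` have product at least `R`
with `r`; it is described so as to be visibly open, which superlevel sets of the product
need not be. -/
def endNhd (o : X) (R : ℝ) (r : GeodesicRay X) : Set (Bordification X)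
  | .inner y => ∃ ε > 0, ∀ y' ∈ Metric.ball y ε, EndsClose o R r.1 fun _ => y'
  | .ideal η => ∃ S : ℝ, ∀ s : GeodesicRay X, s.endpoint = η → ∀ y : X,
      EndsClose o S s.1 (fun _ => y) → EndsClose o R r.1 fun _ => y

lemma endpoint_mem_endNhd (hδ : HyperbolicWith X δ) (o : X) (R : ℝ) (r : GeodesicRay X) :
    Bordification.ideal r.endpoint ∈ endNhd o R r := by
  refine ⟨R + δ, fun s hs y hy => ?_⟩
  have := ((endpoint_eq_iff.1 hs.symm).endsClose o (R + δ)).trans hδ hy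
  simpa using this

lemma isOpen_endNhd (hδ : HyperbolicWith X δ) (o : X) (R : ℝ) (r : GeodesicRay X) :
    IsOpen (endNhd o R r) := by
  constructor
  · rw [Metric.isOpen_iff]
    rintro y ⟨ε, hε, h⟩
    refine ⟨ε / 2, by positivity, fun z hz => ⟨ε / 2, by positivity, fun y' hy' => h y' ?_⟩⟩
    rw [Metric.mem_ball] at *
    linarith [dist_triangle y' z y]
  · rintro η ⟨S, hS⟩ p
    have hδ0 := hδ.nonneg o
    refine ⟨S + dist p o + 2 * δ + 1, fun z hz => ?_⟩
    obtain ⟨s, hs, c, hc, h⟩ := exists_endsClose_of_lt_ext hz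
    have h := h.base o
    cases z with
    | inner y =>
      obtain rfl : c = fun _ => y := hc
      refine ⟨1, one_pos, fun y' hy' => hS s hs y' ?_⟩
      rw [Metric.mem_ball, dist_comm] at hy'
      exact (h.symm.of_dist_le (c'' := fun _ => y') (.of_forall fun _ => hy'.le)).symm.mono
        (by linarith)
    | ideal ζ =>
      obtain ⟨u, hu, rfl⟩ := hc
      refine ⟨S + 2 * δ, fun u' hu' y hy => hS s hs y ?_⟩
      have h1 := (endpoint_eq_iff.1 (hu.trans hu'.symm)).endsClose o (S + 2 * δ)
      have h2 := (h.mono (S := S + 2 * δ) (by linarith)).trans hδ h1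
      exact (h2.trans hδ (hy.mono (by linarith))).mono (by linarith)

/-- The limit set is independent of the orbit and is detected by Gromov products with a ray. -/
lemma mem_limitSet_iff (hδ : HyperbolicWith X δ) (Γ : Subgroup (X ≃ᵢ X)) (x o : X)
    (r : GeodesicRay X) :
    r.endpoint ∈ limitSet Γ x ↔ ∀ R : ℝ, ∃ γ ∈ Γ, EndsClose o R r.1 fun _ => γ o := by
  constructor
  · intro h R
    obtain ⟨z, hz, γ, hγ, rfl⟩ := mem_closure_iff.1 h _ (isOpen_endNhd hδ o (R + dist x o) r)
      (endpoint_mem_endNhd hδ o _ r)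
    obtain ⟨ε, hε, h'⟩ := hz
    refine ⟨γ, hγ, ?_⟩
    have h1 := h' (γ x) (Metric.mem_ball_self hε)
    exact (h1.symm.of_dist_le (c'' := fun _ => γ o) (K := dist x o)
      (.of_forall fun _ => (γ.dist_eq x o).le)).symm.mono (by linarith)
  · intro h
    refine mem_closure_iff.2 fun U hU hξ => ?_
    obtain ⟨R, hR⟩ := hU.2 _ hξ o
    obtain ⟨γ, hγ, h1⟩ := h (R + 1 + dist x o)
    refine ⟨.inner (γ x), hR _ (lt_ext_of_endsClose ?_), γ, hγ, rfl⟩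
    exact (h1.symm.of_dist_le (c'' := fun _ => γ x) (K := dist x o)
      (.of_forall fun _ => (by rw [γ.dist_eq, dist_comm]))).symm.mono (by linarith)

end LimitSet

/-! ### Convergence dynamics -/

section Dynamics

variable {X : Type*} [MetricSpace X] {δ : ℝ} {ι : Type*} {l : Filter ι} {o : X}

lemma EndsTendsto.asymptotic [l.NeBot] (hδ : HyperbolicWith X δ) {c : ι → ℝ≥0 → X}
    {r s : GeodesicRay X} (hr : EndsTendsto o l c r.1) (hs : EndsTendsto o l c s.1) :
    Asymptotic r s := by
  refine .of_endsClose (o := o) hδ fun K => ?_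
  obtain ⟨i, h1, h2⟩ := ((hr (K + δ)).and (hs (K + δ))).exists
  simpa using h1.symm.trans hδ h2

lemma EndsTendsto.of_dist_le {c c' : ι → ℝ≥0 → X} {e : ℝ≥0 → X} (h : EndsTendsto o l c e) {K : ℝ}
    (hK : ∀ᶠ i in l, ∀ t, dist (c i t) (c' i t) ≤ K) : EndsTendsto o l c' e := by
  intro R
  filter_upwards [h (R + K), hK] with i h1 h2
  simpa using h1.of_dist_le (.of_forall h2)

lemma EndsTendsto.map {c : ι → ℝ≥0 → X} {e : ℝ≥0 → X} (h : EndsTendsto o l c e) (γ : X ≃ᵢ X) :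
    EndsTendsto o l (fun i t => γ (c i t)) (fun t => γ (e t)) := by
  intro R
  filter_upwards [h (R + dist (γ o) o)] with i h1
  simpa using h1.map γ

lemma EndsTendsto.dist_tendsto {y : ι → X} {e : ℝ≥0 → X}
    (h : EndsTendsto o l (fun i _ => y i) e) : Tendsto (fun i => dist (y i) o) l atTop := by
  refine tendsto_atTop.2 fun R => (h R).mono fun i hi => ?_
  obtain ⟨t, ht⟩ := hi.exists
  exact ht.trans (gromovProduct_le_left _ _ _)

lemma EndsTendsto.of_asymptotic (hδ : HyperbolicWith X δ) {c : ι → ℝ≥0 → X} {r s : GeodesicRay X}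
    (h : EndsTendsto o l c r.1) (hrs : Asymptotic r s) : EndsTendsto o l c s.1 := by
  intro R
  filter_upwards [h (R + δ)] with i hi
  simpa using hi.trans hδ (hrs.endsClose o (R + δ))

/-- Sequences with distinct limits in `∂X` have bounded Gromov products. -/
lemma EndsTendsto.exists_gromovProduct_lt (hδ : HyperbolicWith X δ) {c c' : ι → ℝ≥0 → X}
    {r s : GeodesicRay X} (h : EndsTendsto o l c r.1) (h' : EndsTendsto o l c' s.1)
    (hrs : ¬ Asymptotic r s) :
    ∃ K : ℝ, ∀ᶠ i in l, ∀ᶠ t in atTop, gromovProduct o (c i t) (c' i t) < K := by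
  obtain ⟨K, hK⟩ := exists_gromovProduct_lt_of_not_asymptotic hδ hrs o
  have hδ0 := hδ.nonneg o
  refine ⟨K + 2 * δ, ?_⟩
  filter_upwards [h (K + 2 * δ), h' (K + 2 * δ)] with i h1 h2
  filter_upwards [h1, h2, hK] with t h1 h2 h3
  by_contra! hc
  rw [gromovProduct_comm] at h1
  have := hδ.chain (R := K + δ) (hδ.chain h1 hc |>.trans' (by linarith)) (h2.trans' (by linarith))
  linarith

/-- Divergent isometries `α i`, with `α i o` tending to `a` and `(α i)⁻¹ o` to `b`, send whatever
stays away from `b` to `a`. -/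
lemma EndsTendsto.image (hδ : HyperbolicWith X δ) {α : ι → X ≃ᵢ X} {c : ι → ℝ≥0 → X}
    {a b e : GeodesicRay X}
    (ha : EndsTendsto o l (fun i _ => α i o) a.1) (hb : EndsTendsto o l (fun i _ => (α i)⁻¹ o) b.1)
    (hc : EndsTendsto o l c e.1) (hbe : ¬ Asymptotic b e) :
    EndsTendsto o l (fun i t => α i (c i t)) a.1 := by
  obtain ⟨K, hK⟩ := hc.exists_gromovProduct_lt hδ hb fun h => hbe h.symm
  intro R
  filter_upwards [ha (R + δ), hK, ha.dist_tendsto.eventually_ge_atTop (K + R + δ)] with i h1 h2 h3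
  have : EndsClose o (R + δ) (fun t => α i (c i t)) (fun _ => α i o) := by
    filter_upwards [h2] with t h2
    rw [gromovProduct_image]; linarith
  simpa using this.trans hδ h1

/-- Bounded families have limits along ultrafilters. -/
lemma exists_tendsto_of_dist_le [ProperSpace X] (𝒰 : Ultrafilter ι) {f : ι → X} {K : ℝ}
    (h : ∀ᶠ i in 𝒰, dist (f i) o ≤ K) : ∃ y, Tendsto f 𝒰 (𝓝 y) := by
  obtain ⟨y, -, hy⟩ := (isCompact_closedBall o K).ultrafilter_le_nhds' (𝒰.map f) h
  exact ⟨y, hy⟩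

/-- Compactness of `X ∪ ∂X` at infinity: a divergent family of points has a limit in `∂X` along any
ultrafilter. -/
lemma exists_endsTendsto [ProperSpace X] (hgeod : IsGeodesicSpace X) (𝒰 : Ultrafilter ι) {y : ι → X}
    (h : Tendsto (fun i => dist (y i) o) 𝒰 atTop) :
    ∃ r : GeodesicRay X, EndsTendsto o (𝒰 : Filter ι) (fun i _ => y i) r.1 := by
  choose c hc using fun i => hgeod o (y i)
  let f : ℝ≥0 → ι → X := fun t i => c i (Set.projIcc 0 (dist o (y i)) dist_nonneg t)
  have hy (T : ℝ) : ∀ᶠ i in (𝒰 : Filter ι), T ≤ dist o (y i) := by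
    simpa only [dist_comm o] using h.eventually_ge_atTop T
  have hf (t : ℝ≥0) : ∀ᶠ i in (𝒰 : Filter ι), dist (f t i) o = t ∧
      dist (f t i) (y i) = dist o (y i) - t := by
    filter_upwards [hy t] with i hi
    have e : (Set.projIcc 0 (dist o (y i)) dist_nonneg (t : ℝ)) = ⟨t, t.2, hi⟩ :=
      Set.projIcc_of_mem _ ⟨t.2, hi⟩
    constructor
    · conv_lhs => rw [← (hc i).2.1]
      simp only [f]
      rw [(hc i).1.dist_eq, e, Subtype.dist_eq, Real.dist_eq]; simp
    · have : dist (f t i) (c i ⟨dist o (y i), dist_nonneg, le_refl _⟩) = dist o (y i) - t := by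
        simp only [f]
        rw [(hc i).1.dist_eq, e, Subtype.dist_eq, Real.dist_eq, abs_sub_comm, abs_of_nonneg]
        simpa using hi
      rwa [(hc i).2.2] at this
  have hlim (t : ℝ≥0) : ∃ z, Tendsto (f t) 𝒰 (𝓝 z) :=
    exists_tendsto_of_dist_le (o := o) (K := t) 𝒰 ((hf t).mono fun i hi => hi.1.le)
  choose r hr using hlim
  have hiso : Isometry r := by
    refine Isometry.of_dist_eq fun s t => tendsto_nhds_unique ((hr s).dist (hr t)) ?_
    refine tendsto_const_nhds.congr' ?_
    filter_upwards [hy s, hy t] with i hs ht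
    simp only [f]
    have es : (Set.projIcc 0 (dist o (y i)) dist_nonneg (s : ℝ)) = ⟨s, s.2, hs⟩ :=
      Set.projIcc_of_mem _ ⟨s.2, hs⟩
    have et : (Set.projIcc 0 (dist o (y i)) dist_nonneg (t : ℝ)) = ⟨t, t.2, ht⟩ :=
      Set.projIcc_of_mem _ ⟨t.2, ht⟩
    rw [(hc i).1.dist_eq, es, et]
    rfl
  refine ⟨⟨r, hiso⟩, fun R => ?_⟩
  set T : ℝ≥0 := (R + 1).toNNReal with hT
  have hRT : R + 1 ≤ T := Real.le_coe_toNNReal _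
  have h0 : dist (r 0) o = 0 := by
    refine tendsto_nhds_unique ((hr 0).dist tendsto_const_nhds) (tendsto_const_nhds.congr' ?_)
    filter_upwards [hf 0] with i hi
    simp [hi.1]
  filter_upwards [(hr T).eventually (Metric.ball_mem_nhds _ one_pos), hf T] with i h1 h2
  filter_upwards [eventually_ge_atTop T] with t ht
  have h3 := GeodesicRay.dist_eq ⟨r, hiso⟩ T t
  have h4 := GeodesicRay.dist_zero ⟨r, hiso⟩ t
  simp only at h3 h4 ⊢
  rw [abs_sub_comm, abs_of_nonneg (by simpa using ht)] at h3
  have h5 := dist_triangle4 (y i) (f T i) (r T) (r t)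
  have h6 := dist_triangle (r 0) o (r t)
  rw [dist_comm (y i) (f T i), h2.2] at h5
  rw [h0, dist_comm o] at h6
  unfold gromovProduct
  rw [dist_comm (y i) o]
  linarith

end Dynamics

/-! ### Convergence of geodesic lines -/

section Lines

variable {X : Type*} [MetricSpace X] {δ : ℝ} {ι : Type*} {o : X}

/-- The image of a geodesic line under an isometry. -/
def GeodesicLine.map (γ : X ≃ᵢ X) (g : GeodesicLine X) : GeodesicLine X :=
  ⟨⟨fun t => γ (g.1 t), γ.continuous.comp g.1.continuous⟩, γ.isometry.comp g.2⟩

lemma GeodesicLine.dist_eq (g : GeodesicLine X) (s t : ℝ) : dist (g.1 s) (g.1 t) = |s - t| := by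
  rw [g.2.dist_eq, Real.dist_eq]

lemma GeodesicLine.not_asymptotic (g : GeodesicLine X) : ¬ Asymptotic g.negRay g.posRay := by
  rintro ⟨C, hC⟩
  have h := hC (C.toNNReal + 1)
  have h1 : dist (g.1 (-((C.toNNReal + 1 : ℝ≥0) : ℝ))) (g.1 ((C.toNNReal + 1 : ℝ≥0) : ℝ)) ≤ C := h
  have h2 := Real.le_coe_toNNReal C
  have h3 : (0 : ℝ) ≤ C.toNNReal := C.toNNReal.2
  rw [g.dist_eq, abs_le] at h1
  push_cast at h1
  linarith

lemma GeodesicLine.flow_posRay (g : GeodesicLine X) (a : ℝ) :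
    Asymptotic (g.flow a).posRay g.posRay := by
  refine ⟨|a|, fun t => ?_⟩
  change dist (g.1 (t + a)) (g.1 t) ≤ _
  rw [g.dist_eq]; simp

lemma GeodesicLine.flow_negRay (g : GeodesicLine X) (a : ℝ) :
    Asymptotic (g.flow a).negRay g.negRay := by
  refine ⟨|a|, fun t => ?_⟩
  change dist (g.1 (-t + a)) (g.1 (-t)) ≤ _
  rw [g.dist_eq]; simp

lemma EndsTendsto.congr_asymptotic {l : Filter ι} (hδ : HyperbolicWith X δ)
    {c c' : ι → GeodesicRay X} {e : ℝ≥0 → X} (h : EndsTendsto o l (fun i => (c i).1) e)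
    (hc : ∀ᶠ i in l, Asymptotic (c' i) (c i)) : EndsTendsto o l (fun i => (c' i).1) e := by
  intro R
  filter_upwards [h (R + δ), hc] with i h1 h2
  simpa using (h2.endsClose o (R + δ)).trans hδ h1

lemma EndsTendsto.const {l : Filter ι} (r : GeodesicRay X) : EndsTendsto o l (fun _ => r.1) r.1 :=
  fun R => .of_forall fun _ => Asymptotic.endsClose ((asymptoticSetoid X).refl r) o R

/-- A pointwise limit of rays whose ends converge has the limit as its end. -/
lemma EndsTendsto.asymptotic_of_pointwise {l : Filter ι} [l.NeBot] (hδ : HyperbolicWith X δ)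
    {c : ι → GeodesicRay X} {r e : GeodesicRay X} (h : EndsTendsto o l (fun i => (c i).1) e.1)
    (hr : ∀ t, Tendsto (fun i => (c i).1 t) l (𝓝 (r.1 t))) : Asymptotic r e := by
  refine .of_endsClose (o := o) hδ fun K => ?_
  set T : ℝ≥0 := (K + 2 * δ + 2 + dist (r.1 0) o).toNNReal with hT
  have hKT : K + 2 * δ + 2 + dist (r.1 0) o ≤ T := Real.le_coe_toNNReal _
  obtain ⟨i, h1, h2, h3⟩ := ((h T).and (((hr T).eventually (Metric.ball_mem_nhds _ one_pos)).and
    ((hr 0).eventually (Metric.ball_mem_nhds _ one_pos)))).exists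
  have h2 : dist ((c i).1 T) (r.1 T) < 1 := h2
  have h3 : dist ((c i).1 0) (r.1 0) < 1 := h3
  have hδ0 := hδ.nonneg o
  have hd := dist_triangle ((c i).1 0) (r.1 0) o
  have hd0 : 0 ≤ dist (r.1 0) o := dist_nonneg
  filter_upwards [h1, eventually_ge_atTop T] with t h1 ht
  have h4 := (c i).le_gromovProduct o ht
  have h5 := gromovProduct_left_sub_le o ((c i).1 T) (r.1 T) ((c i).1 t)
  have h6 := r.le_gromovProduct o ht
  rw [gromovProduct_comm] at h6
  have h7 : K + δ ≤ gromovProduct o (r.1 t) ((c i).1 t) := by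
    have := hδ.chain (R := K + 2 * δ) (h6.trans' (by linarith)) (h5.trans' (by linarith))
    linarith
  have := hδ.chain (R := K + δ) h7 (h1.trans' (by linarith))
  linarith

/-- Lines whose ends converge to the ends of `g` converge to `g` after reparametrization: they pass
near `o` by hyperbolicity, and a limit is a translate of `g` by uniqueness. -/
lemma exists_reparam_tendsto [ProperSpace X] (hδ : HyperbolicWith X δ) (hU : HasUniqueGeodesics X)
    (𝒰 : Ultrafilter ι) {g : GeodesicLine X} {h : ι → GeodesicLine X}
    (hn : EndsTendsto o (𝒰 : Filter ι) (fun i => (h i).negRay.1) g.negRay.1)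
    (hp : EndsTendsto o (𝒰 : Filter ι) (fun i => (h i).posRay.1) g.posRay.1) :
    ∃ a : ι → ℝ, ∀ s, Tendsto (fun i => (h i).1 (s + a i)) 𝒰 (𝓝 (g.1 s)) := by
  obtain ⟨K, hK⟩ := hn.exists_gromovProduct_lt hδ hp g.not_asymptotic
  have hnear : ∀ᶠ i in (𝒰 : Filter ι), ∃ a : ℝ, dist ((h i).1 a) o ≤ K + 2 * δ := by
    filter_upwards [hK] with i hi
    obtain ⟨t, ht⟩ := hi.exists
    obtain ⟨s, -, hs⟩ := hδ.exists_dist_le o (f := (h i).1) (a := -t) (b := t)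
      (by have := t.2; linarith) (fun _ _ _ _ => (h i).dist_eq _ _)
    exact ⟨s, hs.trans (by linarith [show gromovProduct o ((h i).1 (-t)) ((h i).1 t) < K from ht])⟩
  obtain ⟨a, ha⟩ := hnear.choice
  have hlim (s : ℝ) : ∃ z, Tendsto (fun i => (h i).1 (s + a i)) 𝒰 (𝓝 z) := by
    refine exists_tendsto_of_dist_le (o := o) (K := |s| + (K + 2 * δ)) 𝒰 ?_
    filter_upwards [ha] with i hi
    refine (dist_triangle _ ((h i).1 (a i)) _).trans (add_le_add ?_ hi)
    rw [(h i).dist_eq]; simp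
  choose k hk using hlim
  have hiso : Isometry k := by
    refine Isometry.of_dist_eq fun s t => tendsto_nhds_unique ((hk s).dist (hk t)) ?_
    refine tendsto_const_nhds.congr fun i => ?_
    rw [(h i).dist_eq, Real.dist_eq]; simp
  let k' : GeodesicLine X := ⟨⟨k, hiso.continuous⟩, hiso⟩
  have kn : Asymptotic k'.negRay g.negRay :=
    (hn.congr_asymptotic hδ (c' := fun i => ((h i).flow (a i)).negRay)
      (.of_forall fun i => (h i).flow_negRay (a i))).asymptotic_of_pointwise hδ fun t => hk (-t)
  have kp : Asymptotic k'.posRay g.posRay :=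
    (hp.congr_asymptotic hδ (c' := fun i => ((h i).flow (a i)).posRay)
      (.of_forall fun i => (h i).flow_posRay (a i))).asymptotic_of_pointwise hδ fun t => hk t
  obtain ⟨g₀, -, hg₀⟩ := hU.line g.negRay.endpoint g.posRay.endpoint
    fun e => g.not_asymptotic (endpoint_eq_iff.1 e)
  obtain ⟨u, hu⟩ := hg₀ g rfl rfl
  obtain ⟨v, hv⟩ := hg₀ k' (endpoint_eq_iff.2 kn) (endpoint_eq_iff.2 kp)
  refine ⟨fun i => a i + (u - v), fun s => ?_⟩
  have e : g.1 s = k (s + (u - v)) := by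
    have e1 : g.1 s = g₀.1 (s + u) := by
      conv_lhs => rw [hu]
      rfl
    have e2 : k (s + (u - v)) = g₀.1 (s + (u - v) + v) := by
      change k'.1 _ = _
      conv_lhs => rw [hv]
      rfl
    rw [e1, e2]; congr 1; ring
  rw [e]
  refine (hk (s + (u - v))).congr fun i => ?_
  congr 1; ring

/-- Since geodesic lines are equicontinuous, pointwise convergence is convergence in `GX`. -/
lemma tendsto_geodesicLine {l : Filter ι} {h : ι → GeodesicLine X} {g : GeodesicLine X}
    (hs : ∀ s, Tendsto (fun i => (h i).1 s) l (𝓝 (g.1 s))) : Tendsto h l (𝓝 g) := by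
  refine tendsto_subtype_rng.2 (ContinuousMap.tendsto_iff_tendstoLocallyUniformly.2 ?_)
  rw [Metric.tendstoLocallyUniformly_iff]
  intro ε hε x
  refine ⟨Metric.ball x (ε / 3), Metric.ball_mem_nhds _ (by positivity), ?_⟩
  filter_upwards [(hs x).eventually (Metric.ball_mem_nhds _ (by positivity : 0 < ε / 3))]
    with i hi y hy
  have hi : dist ((h i).1 x) (g.1 x) < ε / 3 := hi
  have h1 := dist_triangle4 (g.1 y) (g.1 x) ((h i).1 x) ((h i).1 y)
  have h2 := g.2.dist_eq y x
  have h3 := (h i).2.dist_eq x y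
  rw [dist_comm x y] at h3
  rw [dist_comm (g.1 x)] at h1
  rw [Metric.mem_ball] at hy
  linarith

/-! ### Recurrence of lines with dual ends -/

/-- If the isometries `γ i` push `o` to one end of `g` and their inverses push `o` to the other one,
then the lines from `g(-∞)` to `(γ i)⁻¹ g(+∞)` are close to `g`, and so are their images. -/
lemma exists_tendsto_of_dual [ProperSpace X] (hδ : HyperbolicWith X δ) (hU : HasUniqueGeodesics X)
    (𝒰 : Ultrafilter ι) {g : GeodesicLine X} {γ : ι → X ≃ᵢ X}
    (hn : EndsTendsto o (𝒰 : Filter ι) (fun i _ => γ i o) g.negRay.1)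
    (hp : EndsTendsto o (𝒰 : Filter ι) (fun i _ => (γ i)⁻¹ o) g.posRay.1) :
    ∃ (h : ι → GeodesicLine X) (t : ι → ℝ), Tendsto h 𝒰 (𝓝 g) ∧
      Tendsto (fun i => ((h i).flow (t i)).map (γ i)) 𝒰 (𝓝 g) ∧ Tendsto t 𝒰 atTop := by
  have hna := g.not_asymptotic
  have hn' : EndsTendsto o (𝒰 : Filter ι) (fun i => (g.negRay.map (γ i)).1) g.negRay.1 :=
    hn.image hδ hp (.const g.negRay) fun h => hna h.symm
  have hp' : EndsTendsto o (𝒰 : Filter ι) (fun i => (g.posRay.map (γ i)⁻¹).1) g.posRay.1 :=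
    hp.image hδ (α := fun i => (γ i)⁻¹) (by simpa using hn) (.const g.posRay) hna
  obtain ⟨K, hK⟩ := (EndsTendsto.const g.negRay).exists_gromovProduct_lt hδ hp' hna
  have hex : ∀ᶠ i in (𝒰 : Filter ι), ∃ k : GeodesicLine X,
      Asymptotic k.negRay g.negRay ∧ Asymptotic k.posRay (g.posRay.map (γ i)⁻¹) := by
    filter_upwards [hK] with i hi
    obtain ⟨k, ⟨h1, h2⟩, -⟩ := hU.line g.negRay.endpoint (g.posRay.map (γ i)⁻¹).endpoint
      fun e => by
        obtain ⟨t, h1, h2⟩ := (hi.and ((endpoint_eq_iff.1 e).endsClose o K)).exists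
        linarith
    exact ⟨k, endpoint_eq_iff.1 h1, endpoint_eq_iff.1 h2⟩
  have : Nonempty (GeodesicLine X) := ⟨g⟩
  obtain ⟨k, hk⟩ := hex.choice
  obtain ⟨a, ha⟩ := exists_reparam_tendsto (o := o) hδ hU 𝒰 (g := g) (h := k)
    ((EndsTendsto.const g.negRay).congr_asymptotic hδ (hk.mono fun _ h => h.1))
    (hp'.congr_asymptotic hδ (hk.mono fun _ h => h.2))
  obtain ⟨b, hb⟩ := exists_reparam_tendsto (o := o) hδ hU 𝒰 (g := g) (h := fun i => (k i).map (γ i))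
    (hn'.congr_asymptotic hδ (c' := fun i => ((k i).map (γ i)).negRay)
      (hk.mono fun i h => h.1.map (γ i)))
    ((EndsTendsto.const g.posRay).congr_asymptotic hδ (c' := fun i => ((k i).map (γ i)).posRay)
      (hk.mono fun i h => by
        have := h.2.map (γ i)
        have e : (g.posRay.map (γ i)⁻¹).map (γ i) = g.posRay :=
          Subtype.ext (funext fun t => (γ i).apply_inv_self _)
        rwa [e] at this))
  have hh : Tendsto (fun i => (k i).flow (a i)) 𝒰 (𝓝 g) := tendsto_geodesicLine ha
  refine ⟨fun i => (k i).flow (a i), fun i => b i - a i, hh, tendsto_geodesicLine fun s => ?_, ?_⟩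
  · refine (hb s).congr fun i => ?_
    change γ i ((k i).1 (s + b i)) = γ i ((k i).1 (s + (b i - a i) + a i))
    congr 2; ring
  -- The points `k i (b i)` tend to `g(+∞)`, as `(γ i)⁻¹ o` does; on the negative half of the lines
  -- they would be close to `g(-∞)`.
  have hq : EndsTendsto o (𝒰 : Filter ι) (fun i _ => (k i).1 (b i)) g.posRay.1 := by
    refine hp.of_dist_le (K := dist o (g.1 0) + 1) ?_
    filter_upwards [(hb 0).eventually (Metric.ball_mem_nhds _ one_pos)] with i hi _
    have hi : dist (γ i ((k i).1 (0 + b i))) (g.1 0) < 1 := hi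
    rw [zero_add] at hi
    rw [← (γ i).dist_eq, IsometryEquiv.apply_inv_self]
    have := dist_triangle_right o (γ i ((k i).1 (b i))) (g.1 0)
    linarith
  have hneg : EndsTendsto o (𝒰 : Filter ι) (fun i => ((k i).flow (a i)).negRay.1) g.negRay.1 :=
    (EndsTendsto.const g.negRay).congr_asymptotic hδ
      (hk.mono fun i h => ((k i).flow_negRay (a i)).trans h.1)
  obtain ⟨M, hM⟩ := hq.exists_gromovProduct_lt hδ hneg fun h => hna h.symm
  refine tendsto_atTop.2 fun T => ?_
  filter_upwards [hM, (ha 0).eventually (Metric.ball_mem_nhds _ one_pos),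
    hq.dist_tendsto.eventually_ge_atTop (max T (M + dist (g.1 0) o + 1) + dist (g.1 0) o + 1)]
    with i h1 h2 h3
  have h2 : dist ((k i).1 (0 + a i)) (g.1 0) < 1 := h2
  rw [zero_add] at h2
  have h4 := dist_triangle ((k i).1 (b i)) ((k i).1 (a i)) o
  have h5 := dist_triangle ((k i).1 (a i)) (g.1 0) o
  rw [(k i).dist_eq] at h4
  have h6 : max T (M + dist (g.1 0) o + 1) ≤ |b i - a i| := by linarith
  have h7 := (le_max_left _ _).trans h6
  have h8 := (le_max_right _ _).trans h6
  rcases le_total 0 (b i - a i) with h0 | h0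
  · rwa [abs_of_nonneg h0] at h7
  exfalso
  rw [abs_of_nonpos h0] at h8
  obtain ⟨t, ht, htb⟩ := (h1.and (eventually_ge_atTop (-(b i - a i)).toNNReal)).exists
  have h9 := ((k i).flow (a i)).negRay.le_gromovProduct o htb
  have e1 : ((k i).flow (a i)).negRay.1 (-(b i - a i)).toNNReal = (k i).1 (b i) := by
    change (k i).1 (-((-(b i - a i)).toNNReal : ℝ) + a i) = _
    rw [Real.coe_toNNReal _ (by linarith)]; congr 1; ring
  have e2 : ((k i).flow (a i)).negRay.1 0 = (k i).1 (a i) := by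
    change (k i).1 (-((0 : ℝ≥0) : ℝ) + a i) = _
    simp
  rw [e1, e2, Real.coe_toNNReal _ (by linarith)] at h9
  linarith

/-- A line that is approximated by lines `h` and by `Γ`-images of `t · h`, with `t → ∞`, projects to
a non-wandering point. -/
lemma mk_mem_nonWanderingSet {Γ : Subgroup (X ≃ᵢ X)} {l : Filter ι} [l.NeBot]
    {g : GeodesicLine X} {γ : ι → X ≃ᵢ X} (hγ : ∀ i, γ i ∈ Γ) {h : ι → GeodesicLine X} {t : ι → ℝ}
    (h1 : Tendsto h l (𝓝 g)) (h2 : Tendsto (fun i => ((h i).flow (t i)).map (γ i)) l (𝓝 g))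
    (h3 : Tendsto t l atTop) :
    (Quotient.mk (orbitSetoid Γ) g : QuotientGeodesics Γ) ∈ nonWanderingSet Γ := by
  have : FirstCountableTopology (GeodesicLine X) :=
    Topology.IsInducing.subtypeVal.firstCountableTopology
  have hf : ∃ᶠ p : GeodesicLine X × GeodesicLine X × ℝ in 𝓝 g ×ˢ 𝓝 g ×ˢ atTop,
      ∃ γ ∈ Γ, (p.1.flow p.2.2).map γ = p.2.1 :=
    (h1.prodMk (h2.prodMk h3)).frequently (Eventually.frequently
      (.of_forall fun i => ⟨γ i, hγ i, rfl⟩))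
  obtain ⟨u, hu, huΓ⟩ := exists_seq_forall_of_frequently hf
  have hc : Continuous (fun g : GeodesicLine X => (Quotient.mk (orbitSetoid Γ) g :
    QuotientGeodesics Γ)) := continuous_quot_mk
  have hu2 := tendsto_snd.comp hu
  refine ⟨fun n => Quotient.mk _ (u n).1, fun n => (u n).2.2, tendsto_snd.comp hu2,
    (hc.tendsto g).comp (tendsto_fst.comp hu), ?_⟩
  refine ((hc.tendsto g).comp (tendsto_fst.comp hu2)).congr fun n => ?_
  obtain ⟨γ, hγ, e⟩ := huΓ n
  exact (Quotient.sound (s := orbitSetoid Γ) ⟨γ, hγ, fun s => by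
    simp only [Function.comp]; rw [← e]; rfl⟩).symm

end Lines

/-! ### Non-elementary groups have no fixed end -/

section FixedEnd

variable {X : Type*} [MetricSpace X] {δ : ℝ} {ι : Type*} {o : X}

/-- An isometry `α` that fixes the end of `r` translates `r`, up to a bounded error, as soon as
`α o` is not close to that end; the error does not depend on the translation length. -/
lemma exists_translation (hδ : HyperbolicWith X δ) {r : GeodesicRay X} {α : X ≃ᵢ X}
    (hα : Asymptotic (r.map α) r) {K : ℝ}
    (hK : ∀ᶠ t in atTop, gromovProduct (r.1 0) (α (r.1 0)) (r.1 t) < K) :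
    ∃ s : ℝ≥0, ∀ t : ℝ≥0, dist (α (r.1 (s + t))) (r.1 t) ≤ 4 * (K + 3 * δ) + 4 * δ := by
  obtain ⟨t, h1, h2⟩ := (hK.and (hα.endsClose (r.1 0) (K + δ))).exists
  have h3 : gromovProduct (r.1 0) (α (r.1 0)) (α (r.1 t)) < K + δ := by
    by_contra! hc
    have := hδ.chain hc h2
    linarith
  obtain ⟨s, hs, hs'⟩ := hδ.exists_dist_le (r.1 0) (f := fun x => α (r.1 x.toNNReal)) (a := 0)
    (b := t) t.2 (fun x hx y hy => by
      rw [α.dist_eq, r.dist_eq, Real.coe_toNNReal _ hx.1, Real.coe_toNNReal _ hy.1])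
  simp only [Real.toNNReal_zero, Real.toNNReal_coe] at hs'
  let r' : GeodesicRay X := ⟨fun t => α (r.1 (s.toNNReal + t)), α.isometry.comp (r.2.comp
    (Isometry.of_dist_eq fun x y => by simp [NNReal.dist_eq]))⟩
  have h4 : Asymptotic r' (r.map α) := by
    refine ⟨s.toNNReal, fun t => ?_⟩
    change dist (α (r.1 (s.toNNReal + t))) (α (r.1 t)) ≤ _
    rw [α.dist_eq, r.dist_eq, NNReal.coe_add, add_sub_cancel_right, NNReal.abs_eq]
  have h5 : dist (r'.1 0) (r.1 0) ≤ K + 3 * δ := by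
    change dist (α (r.1 (s.toNNReal + 0))) _ ≤ _
    rw [add_zero]; linarith
  refine ⟨s.toNNReal, r'.dist_le_of_frequently hδ r
    (fun C => ((h4.trans hα).endsClose (r.1 0) C).frequently) h5 ?_⟩
  rw [dist_self]; exact dist_nonneg.trans h5

/-- By the convergence of asymptotic rays, an isometry that fixes the end of `r` translates `r`
up to an error of at most `1` from some time on; only that time and the translation length depend on
the isometry. -/
lemma exists_shift (hC : HasConvergentGeodesics X) {r : GeodesicRay X} {β : X ≃ᵢ X}
    (hβ : Asymptotic (r.map β) r) :
    ∃ a b : ℝ≥0, ∀ t : ℝ≥0, dist (r.1 (t + a)) (β (r.1 (t + b))) ≤ 1 := by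
  obtain ⟨c, hc⟩ := hC r (r.map β) hβ.symm
  obtain ⟨t₀, ht₀⟩ := eventually_atTop.1 (hc.eventually (Iic_mem_nhds one_pos))
  set a : ℝ := max t₀ (max 0 (-c)) with ha
  have h0 : t₀ ≤ a := le_max_left _ _
  have h1 : 0 ≤ a := (le_max_left _ _).trans (le_max_right _ _)
  have h2 : 0 ≤ a + c := by
    have : -c ≤ a := (le_max_right _ _).trans (le_max_right _ _)
    linarith
  refine ⟨a.toNNReal, (a + c).toNNReal, fun t => ?_⟩
  have h := ht₀ (t + a) (by have := t.2; linarith)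
  have e1 : ((t : ℝ) + a).toNNReal = t + a.toNNReal := by
    refine NNReal.eq ?_
    rw [Real.coe_toNNReal _ (add_nonneg t.coe_nonneg h1), NNReal.coe_add, Real.coe_toNNReal _ h1]
  have e2 : ((t : ℝ) + a + c).toNNReal = t + (a + c).toNNReal := by
    refine NNReal.eq ?_
    rw [add_assoc, Real.coe_toNNReal _ (add_nonneg t.coe_nonneg h2), NNReal.coe_add,
      Real.coe_toNNReal _ h2]
  rw [e1, e2] at h
  exact h

/-- Commutators of isometries that translate `r` move its points by a bounded amount. -/
lemma dist_commutator_le {r : GeodesicRay X} {α β : X ≃ᵢ X} {s a b : ℝ≥0} {D : ℝ}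
    (hα : ∀ t : ℝ≥0, dist (α (r.1 (s + t))) (r.1 t) ≤ D)
    (hβ : ∀ t : ℝ≥0, dist (r.1 (t + a)) (β (r.1 (t + b))) ≤ 1) (t : ℝ≥0) :
    dist ((β * α * β⁻¹ * α⁻¹) (r.1 (t + a))) (r.1 (t + a)) ≤ 2 * D + 2 := by
  have h1 : dist (α⁻¹ (r.1 (t + a))) (r.1 (s + (t + a))) ≤ D := by
    rw [← α.dist_eq, α.apply_inv_self, dist_comm]; exact hα _
  have h2 : dist (β⁻¹ (r.1 (s + (t + a)))) (r.1 (s + t + b)) ≤ 1 := by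
    rw [← β.dist_eq, β.apply_inv_self, ← add_assoc]; exact hβ _
  have h3 : dist (α (r.1 (s + t + b))) (r.1 (t + b)) ≤ D := by
    rw [add_assoc]; exact hα _
  have h4 : dist (β (r.1 (t + b))) (r.1 (t + a)) ≤ 1 := by rw [dist_comm]; exact hβ t
  have k2 : dist (β⁻¹ (α⁻¹ (r.1 (t + a)))) (r.1 (s + t + b)) ≤ D + 1 :=
    (dist_triangle _ (β⁻¹ (r.1 (s + (t + a)))) _).trans
      (add_le_add (by rwa [(β⁻¹).dist_eq]) h2)
  have k3 : dist (α (β⁻¹ (α⁻¹ (r.1 (t + a))))) (r.1 (t + b)) ≤ D + 1 + D :=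
    (dist_triangle _ (α (r.1 (s + t + b))) _).trans (add_le_add (by rwa [α.dist_eq]) h3)
  have k4 : dist (β (α (β⁻¹ (α⁻¹ (r.1 (t + a)))))) (r.1 (t + a)) ≤ D + 1 + D + 1 :=
    (dist_triangle _ (β (r.1 (t + b))) _).trans (add_le_add (by rwa [β.dist_eq]) h4)
  exact k4.trans (by linarith)

lemma exists_endsTendsto_orbit (hδ : HyperbolicWith X δ) {Γ : Subgroup (X ≃ᵢ X)} {x : X} (o : X)
    {e : GeodesicRay X} (he : e.endpoint ∈ limitSet Γ x) :
    ∃ α : ℕ → X ≃ᵢ X, (∀ n, α n ∈ Γ) ∧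
      EndsTendsto o (hyperfilter ℕ : Filter ℕ) (fun n _ => α n o) e.1 := by
  choose α hα h using fun n : ℕ => (mem_limitSet_iff hδ Γ x o e).1 he n
  refine ⟨α, hα, fun R => Nat.hyperfilter_le_atTop ?_⟩
  obtain ⟨N, hN⟩ := exists_nat_ge R
  exact (eventually_ge_atTop N).mono fun n hn =>
    (h n).symm.mono (hN.trans (by exact_mod_cast hn))

lemma exists_endsTendsto_inv [ProperSpace X] (hgeod : IsGeodesicSpace X) {𝒰 : Ultrafilter ι}
    {α : ι → X ≃ᵢ X} {c : ℝ≥0 → X} (h : EndsTendsto o (𝒰 : Filter ι) (fun n _ => α n o) c) :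
    ∃ r : GeodesicRay X, EndsTendsto o (𝒰 : Filter ι) (fun n _ => (α n)⁻¹ o) r.1 := by
  refine exists_endsTendsto hgeod 𝒰 (h.dist_tendsto.congr fun i => ?_)
  rw [← (α i).dist_eq ((α i)⁻¹ o) o, (α i).apply_inv_self, dist_comm]

lemma ActsProperlyDiscontinuously.finite_dist_le [ProperSpace X] {Γ : Subgroup (X ≃ᵢ X)}
    (hΓ : ActsProperlyDiscontinuously Γ) (o : X) (M : ℝ) :
    {γ : X ≃ᵢ X | γ ∈ Γ ∧ dist (γ o) o ≤ M}.Finite := by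
  rcases lt_or_ge M 0 with hM | hM
  · refine Set.finite_empty.subset fun γ hγ => ?_
    linarith [hγ.2, dist_nonneg (x := γ o) (y := o)]
  · exact (hΓ _ (isCompact_closedBall o M)).subset fun γ hγ =>
      ⟨hγ.1, γ o, ⟨o, Metric.mem_closedBall_self hM, rfl⟩, hγ.2⟩

/-- A group with infinite limit set does not fix the end of a ray. If it did, choose
`α k` in the group with `α k o` tending to another limit point `e`. The commutators
`f = β (α n) β⁻¹ (α n)⁻¹` move far points of the ray boundedly, so that the `α k f (α k)⁻¹` lie in a
finite set independent of `β`. Since `f` sends `α n o` near `β (α n o)`, the orbit of `e` is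
finite, and every limit point other than the fixed one lies in it. -/
lemma exists_not_asymptotic_map [ProperSpace X] (hgeod : IsGeodesicSpace X)
    (hδ : HyperbolicWith X δ) (hC : HasConvergentGeodesics X) {Γ : Subgroup (X ≃ᵢ X)}
    (hΓ : ActsProperlyDiscontinuously Γ) (hne : IsNonElementary Γ) (r : GeodesicRay X) :
    ∃ σ ∈ Γ, ¬ Asymptotic (r.map σ) r := by
  by_contra! hfix
  obtain ⟨x, hinf⟩ := hne
  set o := r.1 0 with ho
  set 𝒰 : Ultrafilter ℕ := hyperfilter ℕ
  have hA (e : GeodesicRay X) (he : e.endpoint ∈ limitSet Γ x) (her : ¬ Asymptotic r e) :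
      ∃ α : ℕ → X ≃ᵢ X, (∀ n, α n ∈ Γ) ∧ EndsTendsto o (𝒰 : Filter ℕ) (fun n _ => α n o) e.1 ∧
        EndsTendsto o (𝒰 : Filter ℕ) (fun n _ => (α n)⁻¹ o) r.1 := by
    obtain ⟨α, hαΓ, hα⟩ := exists_endsTendsto_orbit hδ o he
    obtain ⟨b, hb⟩ := exists_endsTendsto_inv hgeod hα
    refine ⟨α, hαΓ, hα, hb.of_asymptotic hδ ?_⟩
    by_contra hbr
    have h1 : EndsTendsto o (𝒰 : Filter ℕ) (fun n => (r.map (α n)).1) e.1 :=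
      hα.image hδ hb (.const r) hbr
    have h2 : EndsTendsto o (𝒰 : Filter ℕ) (fun n => (r.map (α n)).1) r.1 :=
      (EndsTendsto.const r).congr_asymptotic hδ (.of_forall fun n => hfix _ (hαΓ n))
    exact her (h2.asymptotic hδ h1)
  obtain ⟨ξ, hξ, hξr⟩ := (hinf.sdiff (Set.finite_singleton r.endpoint)).nonempty
  obtain ⟨e, rfl⟩ := exists_endpoint_eq ξ
  have her : ¬ Asymptotic r e := fun h => hξr (endpoint_eq_iff.2 h.symm)
  obtain ⟨α, hαΓ, hα, hα'⟩ := hA e hξ her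
  obtain ⟨K, hK⟩ := hα.exists_gromovProduct_lt hδ (EndsTendsto.const r) fun h => her h.symm
  set D := 4 * (K + 3 * δ) + 4 * δ
  obtain ⟨s, hs⟩ := (hK.mono fun n hn => exists_translation hδ (hfix _ (hαΓ n)) hn).choice
  have hsa (a : ℝ≥0) : ∀ᶠ n in (𝒰 : Filter ℕ), a ≤ s n := by
    filter_upwards [hs, hα.dist_tendsto.eventually_ge_atTop (a + D)] with n h1 h2
    have h3 := h1 0
    rw [add_zero] at h3
    have h4 := dist_triangle (α n o) (α n (r.1 (s n))) o
    rw [(α n).dist_eq, r.dist_zero] at h4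
    exact_mod_cast (by linarith : (a : ℝ) ≤ s n)
  set F := {γ : X ≃ᵢ X | γ ∈ Γ ∧ dist (γ o) o ≤ 4 * D + 2}
  have hF : F.Finite := hΓ.finite_dist_le o _
  have key (β : X ≃ᵢ X) (hβ : β ∈ Γ) : ∃ φ ∈ F, ∀ᶠ k in (𝒰 : Filter ℕ),
      Asymptotic (e.map ((α k)⁻¹ * φ * α k)) (e.map β) := by
    obtain ⟨a, b, hab⟩ := exists_shift hC (hfix β hβ)
    have h1 : ∀ᶠ k in (𝒰 : Filter ℕ), ∀ᶠ n in (𝒰 : Filter ℕ),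
        ∃ φ ∈ F, α k * (β * α n * β⁻¹ * (α n)⁻¹) * (α k)⁻¹ = φ := by
      filter_upwards [hs, hsa a] with k hk hka
      filter_upwards [hs] with n hn
      refine ⟨_, ⟨Γ.mul_mem (Γ.mul_mem (hαΓ k) (Γ.mul_mem (Γ.mul_mem (Γ.mul_mem hβ (hαΓ n))
        (Γ.inv_mem hβ)) (Γ.inv_mem (hαΓ n)))) (Γ.inv_mem (hαΓ k)), ?_⟩, rfl⟩
      have h2 := dist_commutator_le hn hab (s k - a)
      rw [tsub_add_cancel_of_le hka] at h2
      have h3 := hk 0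
      rw [add_zero] at h3
      set f := β * α n * β⁻¹ * (α n)⁻¹
      have h4 : dist (f ((α k)⁻¹ o)) (f (r.1 (s k))) ≤ D := by
        rw [f.dist_eq, ← (α k).dist_eq, (α k).apply_inv_self, dist_comm]; exact h3
      have h5 := dist_triangle (f ((α k)⁻¹ o)) (f (r.1 (s k))) (r.1 (s k))
      rw [← (α k).dist_eq _ (r.1 (s k))] at h5
      have h6 := dist_triangle (α k (f ((α k)⁻¹ o))) (α k (r.1 (s k))) o
      change dist (α k (f ((α k)⁻¹ o))) o ≤ _
      linarith
    obtain ⟨φ, hφ, h2⟩ := (Ultrafilter.eventually_exists_mem_iff hF).1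
      (h1.mono fun k hk => (Ultrafilter.eventually_exists_mem_iff hF).1 hk)
    refine ⟨φ, hφ, h2.mono fun k hk => ?_⟩
    have h3 : EndsTendsto o (𝒰 : Filter ℕ) (fun n _ => β (α n (β⁻¹ o))) (e.map β).1 :=
      (hα.of_dist_le (c' := fun n _ => α n (β⁻¹ o)) (K := dist o (β⁻¹ o))
        (.of_forall fun n _ => ((α n).dist_eq _ _).le)).map β
    refine EndsTendsto.asymptotic hδ ((hα.map ((α k)⁻¹ * φ * α k)).of_dist_le (K := 0) ?_) h3
    filter_upwards [hk] with n hn _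
    rw [dist_le_zero, ← hn, ← IsometryEquiv.mul_apply, ← IsometryEquiv.mul_apply,
      ← IsometryEquiv.mul_apply]
    congr 1; group
  set O := {η : Boundary X | ∃ β ∈ Γ, (e.map β).endpoint = η}
  have hO : O.Finite := by
    have h1 : ∀ η ∈ O, ∃ φ ∈ F, ∀ᶠ k in (𝒰 : Filter ℕ),
        (e.map ((α k)⁻¹ * φ * α k)).endpoint = η := by
      rintro η ⟨β, hβ, rfl⟩
      obtain ⟨φ, hφ, h⟩ := key β hβ
      exact ⟨φ, hφ, h.mono fun k hk => endpoint_eq_iff.2 hk⟩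
    choose! φ hφ h using h1
    refine Set.Finite.of_injOn (f := φ) hφ (fun η hη η' hη' heq => ?_) hF
    obtain ⟨k, hk, hk'⟩ := ((h η hη).and (h η' hη')).exists
    rw [← hk, ← hk', heq]
  refine hinf ((hO.insert r.endpoint).subset fun ζ hζ => ?_)
  obtain ⟨z, rfl⟩ := exists_endpoint_eq ζ
  by_cases hrz : Asymptotic r z
  · exact .inl (endpoint_eq_iff.2 hrz.symm)
  obtain ⟨β, hβΓ, hβ, hβ'⟩ := hA z hζ hrz
  have h1 : EndsTendsto o (𝒰 : Filter ℕ) (fun n => (e.map (β n)).1) z.1 :=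
    hβ.image hδ hβ' (.const e) her
  obtain ⟨η, hη, h2⟩ := (Ultrafilter.eventually_exists_mem_iff (f := 𝒰)
    (P := fun η n => (e.map (β n)).endpoint = η) hO).1
    (.of_forall fun n => ⟨_, ⟨β n, hβΓ n, rfl⟩, rfl⟩)
  obtain ⟨y, rfl⟩ := exists_endpoint_eq η
  have h3 : EndsTendsto o (𝒰 : Filter ℕ) (fun n => (e.map (β n)).1) y.1 :=
    (EndsTendsto.const y).congr_asymptotic hδ (h2.mono fun n hn => endpoint_eq_iff.1 hn)
  rw [endpoint_eq_iff.2 (h1.asymptotic hδ h3)]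
  exact .inr hη

end FixedEnd

/-! ### The two implications -/

section Main

variable {X : Type*} [MetricSpace X] {δ : ℝ} {Γ : Subgroup (X ≃ᵢ X)}

/-- Any two limit points `ξ` and `η` of a non-elementary group are dual: some `γ n` in the group
satisfy `γ n o → ξ` and `(γ n)⁻¹ o → η`. -/
lemma exists_dual [ProperSpace X] (hgeod : IsGeodesicSpace X) (hδ : HyperbolicWith X δ)
    (hC : HasConvergentGeodesics X) (hΓ : ActsProperlyDiscontinuously Γ) (hne : IsNonElementary Γ)
    {x : X} (o : X) {r s : GeodesicRay X} (hr : r.endpoint ∈ limitSet Γ x)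
    (hs : s.endpoint ∈ limitSet Γ x) :
    ∃ γ : ℕ → X ≃ᵢ X, (∀ n, γ n ∈ Γ) ∧
      EndsTendsto o (hyperfilter ℕ : Filter ℕ) (fun n _ => γ n o) r.1 ∧
      EndsTendsto o (hyperfilter ℕ : Filter ℕ) (fun n _ => (γ n)⁻¹ o) s.1 := by
  obtain ⟨α, hαΓ, hα⟩ := exists_endsTendsto_orbit hδ o hr
  obtain ⟨β, hβΓ, hβ⟩ := exists_endsTendsto_orbit hδ o hs
  obtain ⟨a, ha⟩ := exists_endsTendsto_inv hgeod hα
  obtain ⟨b, hb⟩ := exists_endsTendsto_inv hgeod hβ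
  obtain ⟨σ, hσ, hab⟩ : ∃ σ ∈ Γ, ¬ Asymptotic a (b.map σ) := by
    by_cases h : Asymptotic a b
    · obtain ⟨σ, hσ, h'⟩ := exists_not_asymptotic_map hgeod hδ hC hΓ hne a
      exact ⟨σ, hσ, fun h'' => h' ((h.map σ).trans h''.symm)⟩
    · exact ⟨1, Γ.one_mem, h⟩
  have hba : ¬ Asymptotic b (a.map σ⁻¹) := fun h => hab <| by
    have e : (a.map σ⁻¹).map σ = a := Subtype.ext (funext fun t => σ.apply_inv_self _)
    have h' := h.map σ
    rw [e] at h'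
    exact h'.symm
  have h1 : EndsTendsto o (hyperfilter ℕ : Filter ℕ) (fun n _ => α n (σ ((β n)⁻¹ o))) r.1 :=
    hα.image hδ ha (e := b.map σ) (hb.map σ) hab
  have h2 : EndsTendsto o (hyperfilter ℕ : Filter ℕ) (fun n _ => β n (σ⁻¹ ((α n)⁻¹ o))) s.1 :=
    hβ.image hδ hb (e := a.map σ⁻¹) (ha.map σ⁻¹) hba
  have e (n : ℕ) : (α n * (σ * (β n)⁻¹))⁻¹ = β n * (σ⁻¹ * (α n)⁻¹) := by group
  refine ⟨fun n => α n * (σ * (β n)⁻¹), fun n => Γ.mul_mem (hαΓ n) (Γ.mul_mem hσ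
    (Γ.inv_mem (hβΓ n))), ?_, ?_⟩
  · simpa only [IsometryEquiv.mul_apply] using h1
  · simpa only [e, IsometryEquiv.mul_apply] using h2

lemma nonWanderingSet_eq_univ [ProperSpace X] (hgeod : IsGeodesicSpace X) (hδ : HyperbolicWith X δ)
    (hU : HasUniqueGeodesics X) (hC : HasConvergentGeodesics X)
    (hΓ : ActsProperlyDiscontinuously Γ) (hne : IsNonElementary Γ) {x : X}
    (h : limitSet Γ x = Set.univ) : nonWanderingSet Γ = Set.univ := by
  refine Set.eq_univ_of_forall fun q => ?_
  obtain ⟨g, rfl⟩ := Quotient.exists_rep q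
  obtain ⟨γ, hγΓ, hn, hp⟩ := exists_dual hgeod hδ hC hΓ hne x (r := g.negRay) (s := g.posRay)
    (h ▸ Set.mem_univ _) (h ▸ Set.mem_univ _)
  obtain ⟨k, t, h1, h2, h3⟩ := exists_tendsto_of_dual hδ hU (hyperfilter ℕ) hn hp
  exact mk_mem_nonWanderingSet hγΓ h1 h2 h3

/-- The forward end of a line that is non-wandering modulo `Γ` is a limit point. -/
lemma posRay_endpoint_mem_limitSet (hδ : HyperbolicWith X δ) {g : GeodesicLine X}
    (hg : (Quotient.mk (orbitSetoid Γ) g : QuotientGeodesics Γ) ∈ nonWanderingSet Γ) (x : X) :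
    g.posRay.endpoint ∈ limitSet Γ x := by
  refine (mem_limitSet_iff hδ Γ x (g.1 0) g.posRay).2 fun R => ?_
  obtain ⟨u, t, ht, hu, hut⟩ := hg
  set L : ℝ≥0 := (R + 2).toNNReal
  have hL : R + 2 ≤ L := Real.le_coe_toNNReal _
  let V : Set (QuotientGeodesics Γ) := {q | ∃ h : GeodesicLine X,
    Quotient.mk (orbitSetoid Γ) h = q ∧ dist (h.1 0) (g.1 0) < 1 ∧ dist (h.1 L) (g.1 L) < 1}
  have hV : IsOpen V := by
    have hc (s : ℝ) : Continuous fun h : GeodesicLine X => h.1 s :=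
      (continuous_eval_const s).comp continuous_subtype_val
    have e : (Quotient.mk (orbitSetoid Γ)) ⁻¹' V = ⋃ γ ∈ Γ, {h : GeodesicLine X |
        dist (γ (h.1 0)) (g.1 0) < 1 ∧ dist (γ (h.1 L)) (g.1 L) < 1} := by
      ext h
      simp only [Set.mem_iUnion]
      constructor
      · rintro ⟨k, hk, h1, h2⟩
        obtain ⟨γ, hγ, e⟩ := Quotient.exact hk.symm
        exact ⟨γ, hγ, (by rwa [e] : dist (γ (h.1 0)) _ < 1), (by rwa [e] : dist (γ (h.1 L)) _ < 1)⟩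
      · rintro ⟨γ, hγ, h1, h2⟩
        exact ⟨h.map γ, (Quotient.sound ⟨γ, hγ, fun _ => rfl⟩ :
          Quotient.mk (orbitSetoid Γ) h = Quotient.mk (orbitSetoid Γ) (h.map γ)).symm, h1, h2⟩
    have hopen : IsOpen (⋃ γ ∈ Γ, {h : GeodesicLine X |
        dist (γ (h.1 0)) (g.1 0) < 1 ∧ dist (γ (h.1 L)) (g.1 L) < 1}) :=
      isOpen_biUnion fun γ _ =>
        (isOpen_lt ((γ.continuous.comp (hc 0)).dist continuous_const) continuous_const).inter
          (isOpen_lt ((γ.continuous.comp (hc L)).dist continuous_const) continuous_const)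
    rw [← e] at hopen
    exact isOpen_coinduced.2 hopen
  have hgV : V ∈ 𝓝 (Quotient.mk (orbitSetoid Γ) g : QuotientGeodesics Γ) :=
    hV.mem_nhds ⟨g, rfl, by simp, by simp⟩
  obtain ⟨n, ⟨h, hh, h0, hhL⟩, ⟨k, hk, k0, -⟩, hn⟩ := ((hu.eventually hgV).and
    ((hut.eventually hgV).and (ht.eventually_ge_atTop L))).exists
  rw [← hh] at hk
  obtain ⟨γ, hγ, e⟩ := Quotient.exact (s := orbitSetoid Γ) (b := h.flow (t n)) hk
  refine ⟨γ, hγ, ?_⟩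
  have e0 : γ (k.1 0) = h.1 (0 + t n) := e 0
  rw [zero_add] at e0
  have k1 : dist (h.1 (t n)) (γ (g.1 0)) < 1 := by rwa [← e0, γ.dist_eq]
  filter_upwards [eventually_ge_atTop L] with τ hτ
  have hτ' : (L : ℝ) ≤ τ := by exact_mod_cast hτ
  have hL0 : (0 : ℝ) ≤ L := L.2
  change R ≤ gromovProduct (g.1 0) (g.1 τ) (γ (g.1 0))
  have d1 : dist (g.1 τ) (g.1 0) = τ := by rw [g.dist_eq]; simp
  have d2 : dist (g.1 τ) (g.1 L) = τ - L := by rw [g.dist_eq, abs_of_nonneg]; linarith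
  have d3 : dist (h.1 L) (h.1 (t n)) = t n - L := by
    rw [h.dist_eq, abs_sub_comm, abs_of_nonneg]; linarith
  have d4 : dist (h.1 0) (h.1 (t n)) = t n := by
    rw [h.dist_eq, abs_sub_comm, abs_of_nonneg] <;> linarith
  have d5 := dist_triangle4 (g.1 τ) (g.1 L) (h.1 L) (h.1 (t n))
  have d6 := dist_triangle (g.1 τ) (h.1 (t n)) (γ (g.1 0))
  have d7 := dist_triangle4 (h.1 0) (g.1 0) (γ (g.1 0)) (h.1 (t n))
  rw [dist_comm (g.1 L) (h.1 L)] at d5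
  rw [dist_comm (g.1 0) (γ (g.1 0)), dist_comm (γ (g.1 0)) (h.1 (t n))] at d7
  unfold gromovProduct
  linarith

end Main

end HypFlow

theorem mainTheorem6 {X : Type*} [MetricSpace X] [ProperSpace X]
    (hgeod : HypFlow.IsGeodesicSpace X) (hhyp : HypFlow.IsGromovHyperbolic X)
    (hU : HypFlow.HasUniqueGeodesics X) (hC : HypFlow.HasConvergentGeodesics X)
    (Γ : Subgroup (X ≃ᵢ X)) (hΓ : HypFlow.ActsProperlyDiscontinuously Γ)
    (hne : HypFlow.IsNonElementary Γ) (x : X) :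
    HypFlow.nonWanderingSet Γ = Set.univ ↔ HypFlow.limitSet Γ x = Set.univ := by
  obtain ⟨δ, -, hδ⟩ := hhyp
  refine ⟨fun h => Set.eq_univ_of_forall fun ξ => ?_,
    HypFlow.nonWanderingSet_eq_univ hgeod hδ hU hC hΓ hne⟩
  -- The boundary is infinite, so that `ξ` is the forward end of some line.
  obtain ⟨y, hy⟩ := hne
  obtain ⟨η, -, hη⟩ := (hy.sdiff (Set.finite_singleton ξ)).nonempty
  obtain ⟨g, ⟨-, rfl⟩, -⟩ := hU.line η ξ hη
  exact HypFlow.posRay_endpoint_mem_limitSet hδ (h ▸ Set.mem_univ _) x
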